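/- Fix a constant $p\in(0,1/2)$. For $\mathbf{x}\in\{0,1\}^n$ let $\mathsf{TH}_k(\mathbf{x})=1$ if $\sum_{i=1}^n x_i\ge k$ and $\mathsf{TH}_k(\mathbf{x})=0$ otherwise. A (possibly randomized) variable-length adaptive algorithm may, at each step and depending on its internal randomness and on all previous queries and readings, either query one of the $n$ bits or stop and output one bit; a query of bit $i$ returns $x_i$ flipped with probability $p$, all flips being independent of each other and of the internal randomness. Let $M$ be the total number of queries made (with $M=\infty$ if the algorithm never stops); the worst-case error probability of the algorithm is the maximum over $\mathbf{x}\in\{0,1\}^n$ of the probability that, on input $\mathbf{x}$, it does not output $\mathsf{TH}_k(\mathbf{x})$. Let $D_{\mathrm{KL}}(p\|1-p)$ be the Kullback–Leibler divergence between $\mathsf{Bern}(p)$ and $\mathsf{Bern}(1-p)$, and let $\log$ be the natural logarithm. Let $k=k(n)\ge 1$ be integers with $k=o(n)$ and let $\delta=\delta(n)>0$ with $\delta=o(1)$. Then there is a sequence $\epsilon_n=o(1)$ such that, for all sufficiently large $n$, every variable-length adaptive algorithm on $n$ bits that satisfies $$\mathbb{E}[M\mid\mathbf{x}]\le(1-\epsilon_n)\,\frac{n\log\frac{k}{\delta}}{D_{\mathrm{KL}}(p\|1-p)}\qquad\text{for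 every input }\mathbf{x}\in\{0,1\}^n$$ has worst-case error probability at least $\delta$ for computing $\mathsf{TH}_k$. -/

import Mathlib

open MeasureTheory ProbabilityTheory Filter Asymptotics Topology unitInterval
open scoped ENNReal

universe u

noncomputable section

namespace NoisyThreshold

/-- The threshold-`k` function of `n` bits: `true` iff at least `k` of the bits are one. -/
def threshold {n : ℕ} (k : ℕ) (x : Fin n → Bool) : Bool :=
  decide (k ≤ (Finset.univ.filter (fun i => x i = true)).card)

/-- A (possibly randomized) adaptive, variable-length algorithm that queries `n` bits and
outputs one bit. The internal randomness is a seed, drawn once from `seedLaw`. Given the seed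
and the history so far (the list of pairs (queried index, observed reading), oldest first), the
algorithm either queries another bit, `Sum.inl i`, or stops with an output, `Sum.inr b`. -/
structure Algorithm (n : ℕ) where
  Seed : Type u
  [measurableSpace : MeasurableSpace Seed]
  seedLaw : Measure Seed
  [isProbabilityMeasure : IsProbabilityMeasure seedLaw]
  next : Seed → List (Fin n × Bool) → Fin n ⊕ Bool
  measurable_next : ∀ (h : List (Fin n × Bool)) (a : Fin n ⊕ Bool), MeasurableSet {r | next r h = a}

attribute [instance] Algorithm.measurableSpace Algorithm.isProbabilityMeasure

/-- The law of the noise. The bit `z (i, j)` says whether the reading returned by the `j`-th query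
(counting from `0`) of bit `i` is flipped. These bits are independent, and each of them is
`true` with probability `p`. -/
def noiseLaw (n : ℕ) (p : I) : Measure (Fin n × ℕ → Bool) :=
  Measure.infinitePi fun _ => bernoulliMeasure true false p

namespace Algorithm

variable {n : ℕ}

/-- The history of the algorithm on input `x` after its first `t` queries (or after all its queries,
if it stops before that), when the seed is `r` and the noise is `z`. -/
def history (A : Algorithm.{u} n) (x : Fin n → Bool) (r : A.Seed) (z : Fin n × ℕ → Bool) :
    ℕ → List (Fin n × Bool)
  | 0 => []
  | t + 1 =>
    let h := A.history x r z t
    match A.next r h with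
    | Sum.inl i => h ++ [(i, xor (x i) (z (i, h.countP fun q => q.1 = i)))]
    | Sum.inr _ => h

/-- The total number of queries (`∞` if the algorithm never stops). -/
def numQueries (A : Algorithm.{u} n) (x : Fin n → Bool) (r : A.Seed) (z : Fin n × ℕ → Bool) :
    ℝ≥0∞ :=
  ⨆ t : ℕ, ((A.history x r z t).length : ℝ≥0∞)

/-- The algorithm stops, and its output is `b`. -/
def Outputs (A : Algorithm.{u} n) (x : Fin n → Bool) (r : A.Seed) (z : Fin n × ℕ → Bool)
    (b : Bool) : Prop :=
  ∃ t : ℕ, A.next r (A.history x r z t) = Sum.inr b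

/-- The joint law of the seed and the noise, which are independent. -/
def law (A : Algorithm.{u} n) (p : I) : Measure (A.Seed × (Fin n × ℕ → Bool)) :=
  A.seedLaw.prod (noiseLaw n p)

/-- The expected number of queries on input `x`. -/
def expectedQueries (A : Algorithm.{u} n) (p : I) (x : Fin n → Bool) : ℝ≥0∞ :=
  ∫⁻ ω, A.numQueries x ω.1 ω.2 ∂A.law p

/-- The probability that, on input `x`, the algorithm does not output `f x`. -/
def errorProb (A : Algorithm.{u} n) (p : I) (f : (Fin n → Bool) → Bool) (x : Fin n → Bool) :
    ℝ≥0∞ :=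
  A.law p {ω | ¬ A.Outputs x ω.1 ω.2 (f x)}

/-- The worst-case error probability of the algorithm for computing `f`. -/
def worstCaseError (A : Algorithm.{u} n) (p : I) (f : (Fin n → Bool) → Bool) : ℝ≥0∞ :=
  ⨆ x : Fin n → Bool, A.errorProb p f x

end Algorithm

/-- The Kullback-Leibler divergence `D_KL(p ‖ q)` between `Bern(p)` and `Bern(q)`. -/
def klBernoulli (p q : I) : ℝ :=
  (InformationTheory.klDiv (bernoulliMeasure true false p) (bernoulliMeasure true false q)).toReal

end NoisyThreshold

end

/-! Write `k + 1` for the threshold. The hard instances are the sets `s` of `k + 1` ones (answer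
true) and their neighbours `s.erase i` (answer false). Let `score p i` be the log-likelihood ratio
of "bit `i` is zero" to "bit `i` is one". By the change of measure `mean_eq_mean_update`, the
probability of an event under `s.erase i` is the integral of `exp (score p i)` over it under `s`.
All `k + 1` neighbours are compared with the same input `s`, on which output false has probability
at most `δ`. If output false came with `∑ j ∈ s, exp (score p j) ≤ W`, the neighbours would
therefore have total probability at most `W * δ` of that event (`sum_mean_plausiblyFalse_le`), while
correctness wants this total to be close to `k + 1`. Sharing one budget `δ` among `k + 1` neighbours
is what produces `log (k / δ)` rather than `log (1 / δ)`.

Take `W = exp B + (k + 1) * K`. Under `s.erase i` the event can fail in three ways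
(`one_le_mean_plausiblyFalse_add`): the output is not false; or `score p i` exceeds `B`; or the
other ones of `s` contribute more than `(k + 1) * K`. The last is rare by Markov, since each such
`exp (score p j)` has mean one. For the second, the score of a zero bit gains `(1 - 2p) * logOdds
p`, which is the divergence, per query on average, so Markov and Wald's identity (`mean_potential`)
bound it by the expected number of queries of bit `i`, up to a term `1 / B`.

Averaging over all pairs `(s, i)`, equivalently over `k`-sets and an element outside, replaces that
number by at most `Q / (n - k)`. This gives `one_le_of_worstCaseError_lt`. With `B = (1 - ε / 2) *
log (k / δ)`, now for threshold `k`, its right side tends to a limit below one, a contradiction. -/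

noncomputable section

namespace NoisyThreshold

variable {n : ℕ}

/-! ### Noise bits, and independence of the next reading from the history -/

/-- The probability that a noise bit equals `c`. -/
def flipMass (p : I) (c : Bool) : ℝ≥0∞ := ENNReal.ofReal (if c then (p : ℝ) else 1 - p)

lemma bernoulliMeasure_singleton (p : I) (c : Bool) :
    bernoulliMeasure true false p {c} = flipMass p c := by
  have hp := p.2.1
  have hp' := p.2.2
  cases c <;> simp [flipMass, toNNReal, ENNReal.ofReal,
    Real.toNNReal_of_nonneg, hp, hp'] <;> rfl

lemma flipMass_add (p : I) : flipMass p true + flipMass p false = 1 := by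
  have hp := p.2.1
  have hp' := p.2.2
  rw [flipMass, flipMass, ← ENNReal.ofReal_add (by simpa using hp) (by simpa using hp')]
  simp

instance (p : I) : IsProbabilityMeasure (noiseLaw n p) := by
  unfold noiseLaw; infer_instance

instance (A : Algorithm.{u} n) (p : I) : IsProbabilityMeasure (A.law p) := by
  unfold Algorithm.law; infer_instance

lemma noiseLaw_cylinder (p : I) (s : Finset (Fin n × ℕ)) (f : Fin n × ℕ → Bool) :
    noiseLaw n p {z | ∀ q ∈ s, z q = f q} = ∏ q ∈ s, flipMass p (f q) := by
  have : {z : Fin n × ℕ → Bool | ∀ q ∈ s, z q = f q} = Set.pi (s : Set (Fin n × ℕ))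
      (fun q => {f q}) := by
    ext z; simp [Set.mem_pi]
  rw [this, noiseLaw, Measure.infinitePi_pi _ (fun _ _ => measurableSet_singleton _)]
  simp [bernoulliMeasure_singleton]

namespace Algorithm

/-- The noise outcomes that lead to a given unfinished history form a cylinder whose base consists
of noise bits that have been read. -/
lemma history_eq_cylinder (A : Algorithm.{u} n) (x : Fin n → Bool) (r : A.Seed) (t : ℕ)
    (h : List (Fin n × Bool)) (i : Fin n) (hi : A.next r h = Sum.inl i) :
    {z | A.history x r z t = h} = ∅ ∨ ∃ (s : Finset (Fin n × ℕ)) (f : Fin n × ℕ → Bool),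
      (∀ q ∈ s, q.2 < h.countP fun a => a.1 = q.1) ∧
      {z | A.history x r z t = h} = {z | ∀ q ∈ s, z q = f q} := by
  induction t generalizing h i with
  | zero =>
    by_cases hh : h = []
    · right
      refine ⟨∅, fun _ => true, by simp, ?_⟩
      ext z; simp [history, hh]
    · left
      ext z; simpa [history] using fun h' : [] = h => hh h'.symm
  | succ t ih =>
    -- At a positive time the history is empty only if the algorithm stopped at once, which `hi`
    -- excludes. Otherwise the last entry must come from a query made in this very step.
    rcases List.eq_nil_or_concat h with rfl | ⟨h', ⟨j, b⟩, rfl⟩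
    · left
      ext z
      simp only [Set.mem_ofPred_eq, Set.mem_empty_iff_false, iff_false, history]
      intro hz
      split at hz
      · simp at hz
      · rename_i b hb
        rw [hz, hi] at hb; cases hb
    · by_cases hj : A.next r h' = Sum.inl j
      · have key : ∀ z, A.history x r z (t + 1) = h' ++ [(j, b)] ↔
            A.history x r z t = h' ∧ z (j, h'.countP fun q => q.1 = j) = xor (x j) b := by
          intro z
          simp only [history]
          constructor
          · intro hz
            split at hz
            · rename_i i' hi'
              obtain ⟨h1, h2⟩ := List.append_inj' hz rfl
              simp only [List.cons.injEq, Prod.mk.injEq, and_true] at h2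
              obtain ⟨rfl, h2⟩ := h2
              rw [h1] at h2
              refine ⟨h1, ?_⟩
              rw [← h2]; simp
            · rename_i b' hb'
              rw [hz] at hb'
              rw [List.concat_eq_append] at hi
              rw [hi] at hb'; cases hb'
          · rintro ⟨h1, h2⟩
            rw [h1, hj]
            simp [h2]
        simp only [List.concat_eq_append, key]
        rcases ih h' j hj with h0 | ⟨s, f, hs, hf⟩
        · left
          ext z
          have : z ∉ {z | A.history x r z t = h'} := by rw [h0]; simp
          simp only [Set.mem_ofPred_eq] at this
          simp [this]
        · right
          -- The bit read now is fresh: the base `s` only contains indices below the current query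
          -- count of each position.
          have hq : (j, h'.countP fun q => q.1 = j) ∉ s := fun hq => by
            simpa using hs _ hq
          refine ⟨insert (j, h'.countP fun q => q.1 = j) s,
            Function.update f (j, h'.countP fun q => q.1 = j) (xor (x j) b), ?_, ?_⟩
          · intro q hq'
            rw [List.countP_append]
            rcases Finset.mem_insert.1 hq' with rfl | hq'
            · simp
            · exact (hs q hq').trans_le (Nat.le_add_right _ _)
          · ext z
            have h3 : A.history x r z t = h' ↔ ∀ q ∈ s, z q = f q :=
              Set.ext_iff.1 hf z
            simp only [Set.mem_ofPred_eq, h3, Finset.forall_mem_insert, Function.update_self]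
            rw [and_comm]
            refine and_congr_right fun _ => forall₂_congr fun q hqs => ?_
            rw [Function.update_of_ne (ne_of_mem_of_not_mem hqs hq)]
      · left
        ext z
        simp only [Set.mem_ofPred_eq, Set.mem_empty_iff_false, iff_false, history,
          List.concat_eq_append]
        intro hz
        split at hz
        · rename_i i' hi'
          obtain ⟨h1, h2⟩ := List.append_inj' hz rfl
          simp only [List.cons.injEq, Prod.mk.injEq, and_true] at h2
          rw [h1, h2.1] at hi'
          exact hj hi'
        · rename_i b' hb'
          rw [List.concat_eq_append] at hi
          rw [hz, hi] at hb'; cases hb'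

/-- The next noise bit to be read is independent of the past. -/
lemma noiseLaw_history_inter (A : Algorithm.{u} n) (p : I) (x : Fin n → Bool) (r : A.Seed) (t : ℕ)
    (h : List (Fin n × Bool)) (i : Fin n) (hi : A.next r h = Sum.inl i) (c : Bool) :
    noiseLaw n p ({z | z (i, h.countP fun q => q.1 = i) = c} ∩ {z | A.history x r z t = h}) =
      flipMass p c * noiseLaw n p {z | A.history x r z t = h} := by
  rcases A.history_eq_cylinder x r t h i hi with h0 | ⟨s, f, hs, hf⟩
  · simp [h0]
  · have hq : (i, h.countP fun q => q.1 = i) ∉ s := fun hq => by simpa using hs _ hq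
    rw [hf, noiseLaw_cylinder]
    have : {z : Fin n × ℕ → Bool | z (i, h.countP fun q => q.1 = i) = c} ∩
        {z | ∀ q ∈ s, z q = f q} = {z | ∀ q ∈ insert (i, h.countP fun q => q.1 = i) s,
          z q = Function.update f (i, h.countP fun q => q.1 = i) c q} := by
      ext z
      simp only [Set.mem_inter_iff, Set.mem_ofPred_eq, Finset.forall_mem_insert,
        Function.update_self]
      refine and_congr_right fun _ => forall₂_congr fun q hqs => ?_
      rw [Function.update_of_ne (ne_of_mem_of_not_mem hqs hq)]
    rw [this, noiseLaw_cylinder, Finset.prod_insert hq, Function.update_self]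
    congr 1
    refine Finset.prod_congr rfl fun q hqs => ?_
    rw [Function.update_of_ne (ne_of_mem_of_not_mem hqs hq)]

/-! ### Measurability and one-step conditional expectations -/

lemma measurableSet_history (A : Algorithm.{u} n) (x : Fin n → Bool) (t : ℕ)
    (h : List (Fin n × Bool)) :
    MeasurableSet {ω : A.Seed × (Fin n × ℕ → Bool) | A.history x ω.1 ω.2 t = h} := by
  induction t generalizing h with
  | zero => simp [history]
  | succ t ih =>
    let res : List (Fin n × Bool) → Fin n ⊕ Bool → (Fin n × ℕ → Bool) → List (Fin n × Bool) :=
      fun h a z => match a with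
        | Sum.inl i => h ++ [(i, xor (x i) (z (i, h.countP fun q => q.1 = i)))]
        | Sum.inr _ => h
    have hres : ∀ h a h', MeasurableSet {ω : A.Seed × (Fin n × ℕ → Bool) | res h a ω.2 = h'} := by
      intro h a h'
      rcases a with i | b
      · have : {ω : A.Seed × (Fin n × ℕ → Bool) | res h (Sum.inl i) ω.2 = h'} =
          (fun ω : A.Seed × (Fin n × ℕ → Bool) => ω.2 (i, h.countP fun q => q.1 = i)) ⁻¹'
            {c | h ++ [(i, xor (x i) c)] = h'} := rfl
        rw [this]
        exact ((measurable_pi_apply _).comp measurable_snd) (MeasurableSet.of_discrete)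
      · exact MeasurableSet.const (h = h')
    have : {ω : A.Seed × (Fin n × ℕ → Bool) | A.history x ω.1 ω.2 (t + 1) = h} =
        ⋃ (h' : List (Fin n × Bool)) (a : Fin n ⊕ Bool),
          {ω | A.history x ω.1 ω.2 t = h'} ∩ ({ω | A.next ω.1 h' = a} ∩ {ω | res h' a ω.2 = h}) := by
      ext ω
      simp only [Set.mem_ofPred_eq, Set.mem_iUnion, Set.mem_inter_iff]
      constructor
      · intro hω
        refine ⟨_, _, rfl, rfl, ?_⟩
        rw [← hω]
        rcases hn : A.next ω.1 (A.history x ω.1 ω.2 t) <;> simp [history, res, hn]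
      · rintro ⟨h', a, rfl, rfl, hω⟩
        rw [← hω]
        rcases hn : A.next ω.1 (A.history x ω.1 ω.2 t) <;> simp [history, res, hn]
    rw [this]
    exact MeasurableSet.iUnion fun h' => MeasurableSet.iUnion fun a =>
      (ih h').inter (((A.measurable_next h' a).preimage measurable_fst).inter (hres h' a h))

/-- There are only countably many histories, so measurability in the seed for each fixed history is
enough. -/
lemma measurable_comp_history (A : Algorithm.{u} n) (x : Fin n → Bool) (t : ℕ)
    (g : A.Seed → List (Fin n × Bool) → ℝ≥0∞) (hg : ∀ h, Measurable fun r => g r h) :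
    Measurable fun ω : A.Seed × (Fin n × ℕ → Bool) => g ω.1 (A.history x ω.1 ω.2 t) := by
  intro S hS
  have : (fun ω : A.Seed × (Fin n × ℕ → Bool) => g ω.1 (A.history x ω.1 ω.2 t)) ⁻¹' S =
      ⋃ h, {ω | A.history x ω.1 ω.2 t = h} ∩ {ω | g ω.1 h ∈ S} := by
    ext ω; simp
  rw [this]
  exact MeasurableSet.iUnion fun h => (A.measurableSet_history x t h).inter
    (((hg h).comp measurable_fst) hS)

/-- The expected value of a function of the seed and of the history after `t` steps. -/
def mean (A : Algorithm.{u} n) (p : I) (x : Fin n → Bool) (t : ℕ)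
    (g : A.Seed → List (Fin n × Bool) → ℝ≥0∞) : ℝ≥0∞ :=
  ∫⁻ ω, g ω.1 (A.history x ω.1 ω.2 t) ∂A.law p

/-- The conditional expectation of `g` after one more step. -/
def step (A : Algorithm.{u} n) (p : I) (x : Fin n → Bool)
    (g : A.Seed → List (Fin n × Bool) → ℝ≥0∞) (r : A.Seed) (h : List (Fin n × Bool)) : ℝ≥0∞ :=
  match A.next r h with
  | Sum.inl i => ∑ b, flipMass p (xor (x i) b) * g r (h ++ [(i, b)])
  | Sum.inr _ => g r h

lemma measurable_step (A : Algorithm.{u} n) (p : I) (x : Fin n → Bool)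
    (g : A.Seed → List (Fin n × Bool) → ℝ≥0∞) (hg : ∀ h, Measurable fun r => g r h)
    (h : List (Fin n × Bool)) : Measurable fun r => A.step p x g r h := by
  let F : Fin n ⊕ Bool → A.Seed → ℝ≥0∞ := fun a r => match a with
    | Sum.inl i => ∑ b, flipMass p (xor (x i) b) * g r (h ++ [(i, b)])
    | Sum.inr _ => g r h
  have hF : ∀ a, Measurable (F a) := by
    rintro (i | b)
    · exact Finset.measurable_sum _ fun b _ => (hg _).const_mul _
    · exact hg h
  intro S hS
  have : (fun r => A.step p x g r h) ⁻¹' S = ⋃ a, {r | A.next r h = a} ∩ {r | F a r ∈ S} := by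
    ext r; simp [step, F]
  rw [this]
  exact MeasurableSet.iUnion fun a => (A.measurable_next h a).inter (hF a hS)

lemma measurableSet_history_noise (A : Algorithm.{u} n) (x : Fin n → Bool) (r : A.Seed) (t : ℕ)
    (h : List (Fin n × Bool)) : MeasurableSet {z | A.history x r z t = h} :=
  (A.measurableSet_history x t h).preimage measurable_prodMk_left

/-- The noise space is split by the value of the history. On a cell where the algorithm queries, the
next noise bit keeps its unconditional law by `noiseLaw_history_inter`; on a cell where it has
stopped, nothing changes. -/
lemma lintegral_step (A : Algorithm.{u} n) (p : I) (x : Fin n → Bool) (r : A.Seed) (t : ℕ)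
    (g : A.Seed → List (Fin n × Bool) → ℝ≥0∞) :
    ∫⁻ z, g r (A.history x r z (t + 1)) ∂noiseLaw n p =
      ∫⁻ z, A.step p x g r (A.history x r z t) ∂noiseLaw n p := by
  have hU : (⋃ h, {z | A.history x r z t = h}) = Set.univ := by ext z; simp
  have hd : Pairwise (Function.onFun Disjoint fun h => {z | A.history x r z t = h}) := by
    intro h h' hne
    rw [Function.onFun, Set.disjoint_left]
    intro z hz hz'
    exact hne (hz.symm.trans hz')
  rw [← setLIntegral_univ, ← setLIntegral_univ (fun z => A.step p x g r _), ← hU,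
    lintegral_iUnion (A.measurableSet_history_noise x r t) hd,
    lintegral_iUnion (A.measurableSet_history_noise x r t) hd]
  congr 1
  funext h
  have hS := A.measurableSet_history_noise x r t h
  rcases hn : A.next r h with i | b
  · have h1 : ∫⁻ z in {z | A.history x r z t = h}, g r (A.history x r z (t + 1)) ∂noiseLaw n p =
        ∫⁻ z in {z | A.history x r z t = h},
          g r (h ++ [(i, xor (x i) (z (i, h.countP fun q => q.1 = i)))]) ∂noiseLaw n p := by
      refine setLIntegral_congr_fun hS fun z hz => ?_
      simp only [Set.mem_ofPred_eq] at hz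
      simp only [history, hz, hn]
    have h2 : ∫⁻ z in {z | A.history x r z t = h}, A.step p x g r (A.history x r z t) ∂noiseLaw n p =
        ∫⁻ z in {z | A.history x r z t = h},
          ∑ b, flipMass p (xor (x i) b) * g r (h ++ [(i, b)]) ∂noiseLaw n p := by
      refine setLIntegral_congr_fun hS fun z hz => ?_
      simp only [Set.mem_ofPred_eq] at hz
      simp only [step, hz, hn]
    have hev : Measurable fun z : Fin n × ℕ → Bool => z (i, h.countP fun q => q.1 = i) :=
      measurable_pi_apply _
    rw [h1, h2, setLIntegral_const,
      ← lintegral_map (f := fun c => g r (h ++ [(i, xor (x i) c)])) (measurable_of_countable _) hev,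
      lintegral_fintype]
    have h3 : ∀ c : Bool, (Measure.map (fun z : Fin n × ℕ → Bool =>
        z (i, h.countP fun q => q.1 = i)) ((noiseLaw n p).restrict {z | A.history x r z t = h})) {c} =
        flipMass p c * noiseLaw n p {z | A.history x r z t = h} := by
      intro c
      rw [Measure.map_apply hev (measurableSet_singleton _), Measure.restrict_apply
        (hev (measurableSet_singleton _)), ← A.noiseLaw_history_inter p x r t h i hn c]
      rfl
    simp only [h3, Fintype.sum_bool]
    cases x i <;> simp <;> ring
  · refine setLIntegral_congr_fun hS fun z hz => ?_
    simp only [Set.mem_ofPred_eq] at hz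
    simp only [history, step, hz, hn]

lemma mean_zero (A : Algorithm.{u} n) (p : I) (x : Fin n → Bool)
    (g : A.Seed → List (Fin n × Bool) → ℝ≥0∞) (hg : ∀ h, Measurable fun r => g r h) :
    A.mean p x 0 g = ∫⁻ r, g r [] ∂A.seedLaw := by
  rw [mean, law, lintegral_prod _ (A.measurable_comp_history x 0 g hg).aemeasurable]
  simp [history]

lemma mean_succ (A : Algorithm.{u} n) (p : I) (x : Fin n → Bool) (t : ℕ)
    (g : A.Seed → List (Fin n × Bool) → ℝ≥0∞) (hg : ∀ h, Measurable fun r => g r h) :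
    A.mean p x (t + 1) g = A.mean p x t (A.step p x g) := by
  rw [mean, mean, law, lintegral_prod _ (A.measurable_comp_history x (t + 1) g hg).aemeasurable,
    lintegral_prod _ (A.measurable_comp_history x t _ (A.measurable_step p x g hg)).aemeasurable]
  exact lintegral_congr fun r => A.lintegral_step p x r t g

end Algorithm

/-! ### Log-likelihood ratios and the potential -/

/-- The log-odds of a correct reading. -/
def logOdds (p : I) : ℝ := Real.log ((1 - p) / p)

/-- The log-likelihood ratio of the hypotheses that bit `i` is zero and that it is one. -/
def score (p : I) (i : Fin n) (h : List (Fin n × Bool)) : ℝ :=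
  ((h.count (i, false) : ℝ) - h.count (i, true)) * logOdds p

@[simp]
lemma score_nil (p : I) (i : Fin n) : score p i [] = 0 := by simp [score]

lemma score_append_of_ne (p : I) {i j : Fin n} (hij : j ≠ i) (h : List (Fin n × Bool)) (b : Bool) :
    score p i (h ++ [(j, b)]) = score p i h := by
  simp [score, List.count_append, hij]

lemma score_append_false (p : I) (i : Fin n) (h : List (Fin n × Bool)) :
    score p i (h ++ [(i, false)]) = score p i h + logOdds p := by
  simp [score, List.count_append]; ring

lemma score_append_true (p : I) (i : Fin n) (h : List (Fin n × Bool)) :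
    score p i (h ++ [(i, true)]) = score p i h - logOdds p := by
  simp [score, List.count_append]; ring

lemma flipMass_true (p : I) : flipMass p true = ENNReal.ofReal p := by simp [flipMass]

lemma flipMass_false (p : I) : flipMass p false = ENNReal.ofReal (1 - p) := by simp [flipMass]

lemma mul_exp_logOdds {p : I} (hp : 0 < (p : ℝ)) (hp' : (p : ℝ) < 1) :
    p * Real.exp (logOdds p) = 1 - p := by
  rw [logOdds, Real.exp_log (div_pos (by linarith) hp)]
  field_simp

lemma mul_exp_neg_logOdds {p : I} (hp : 0 < (p : ℝ)) (hp' : (p : ℝ) < 1) :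
    (1 - p) * Real.exp (-logOdds p) = p := by
  rw [logOdds, Real.exp_neg, Real.exp_log (div_pos (by linarith) hp)]
  have : (1 - p : ℝ) ≠ 0 := by linarith
  field_simp

lemma logOdds_pos {p : I} (hp : 0 < (p : ℝ)) (hp' : (p : ℝ) < 1 / 2) : 0 < logOdds p :=
  Real.log_pos (by rw [lt_div_iff₀ hp]; linarith)

lemma add_exp_neg_nonneg (u : ℝ) : 0 ≤ u + Real.exp (-u) := by
  linarith [Real.add_one_le_exp (-u)]

/-- A nonnegative upper bound for the positive part of the score, with a linear drift. -/
def potential (p : I) (i : Fin n) (h : List (Fin n × Bool)) : ℝ≥0∞ :=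
  ENNReal.ofReal (score p i h + Real.exp (-score p i h))

/-! ### Change of measure and Wald's identity -/

namespace Algorithm

lemma mean_const (A : Algorithm.{u} n) (p : I) (x : Fin n → Bool) (t : ℕ) (c : ℝ≥0∞) :
    A.mean p x t (fun _ _ => c) = c := by
  simp [mean]

lemma mean_mono (A : Algorithm.{u} n) (p : I) (x : Fin n → Bool) (t : ℕ)
    {g g' : A.Seed → List (Fin n × Bool) → ℝ≥0∞} (hg : ∀ r h, g r h ≤ g' r h) :
    A.mean p x t g ≤ A.mean p x t g' :=
  lintegral_mono fun _ => hg _ _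

lemma mean_add (A : Algorithm.{u} n) (p : I) (x : Fin n → Bool) (t : ℕ)
    (g g' : A.Seed → List (Fin n × Bool) → ℝ≥0∞) (hg : ∀ h, Measurable fun r => g r h) :
    A.mean p x t (fun r h => g r h + g' r h) = A.mean p x t g + A.mean p x t g' :=
  lintegral_add_left (A.measurable_comp_history x t g hg) _

lemma mean_const_mul (A : Algorithm.{u} n) (p : I) (x : Fin n → Bool) (t : ℕ) (c : ℝ≥0∞)
    (g : A.Seed → List (Fin n × Bool) → ℝ≥0∞) (hg : ∀ h, Measurable fun r => g r h) :
    A.mean p x t (fun r h => c * g r h) = c * A.mean p x t g :=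
  lintegral_const_mul _ (A.measurable_comp_history x t g hg)

lemma mean_finset_sum (A : Algorithm.{u} n) (p : I) (x : Fin n → Bool) (t : ℕ) {ι : Type*}
    (s : Finset ι) (g : ι → A.Seed → List (Fin n × Bool) → ℝ≥0∞)
    (hg : ∀ i h, Measurable fun r => g i r h) :
    A.mean p x t (fun r h => ∑ i ∈ s, g i r h) = ∑ i ∈ s, A.mean p x t (g i) :=
  lintegral_finsetSum _ fun i _ => A.measurable_comp_history x t (g i) (hg i)

/-- Change of measure between two inputs that differ in one bit. -/
lemma mean_eq_mean_update (A : Algorithm.{u} n) {p : I} (hp : 0 < (p : ℝ)) (hp' : (p : ℝ) < 1)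
    (x : Fin n → Bool) (i : Fin n) (hi : x i = false) (t : ℕ)
    (g : A.Seed → List (Fin n × Bool) → ℝ≥0∞) (hg : ∀ h, Measurable fun r => g r h) :
    A.mean p x t g = A.mean p (Function.update x i true) t
      (fun r h => ENNReal.ofReal (Real.exp (score p i h)) * g r h) := by
  induction t generalizing g with
  | zero =>
    rw [mean_zero _ _ _ _ hg, mean_zero _ _ _ _ fun h => (hg h).const_mul _]
    simp
  | succ t ih =>
    rw [mean_succ _ _ _ _ _ hg, mean_succ _ _ _ _ _ fun h => (hg h).const_mul _,
      ih _ (A.measurable_step p x g hg)]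
    congr 1
    funext r h
    simp only [step]
    rcases A.next r h with j | b
    · simp only [Fintype.sum_bool]
      by_cases hj : j = i
      · subst hj
        have h1p : (0 : ℝ) ≤ 1 - p := by linarith
        -- A reading of zero has probability `1 - p` when the bit is zero and `p` when it is one;
        -- the quotient is exactly the factor by which `exp (score p j)` grows. `e1` is the same for
        -- a reading of one.
        have e0 : ENNReal.ofReal (Real.exp (score p j h)) * ENNReal.ofReal (1 - p) =
            ENNReal.ofReal p * ENNReal.ofReal (Real.exp (score p j (h ++ [(j, false)]))) := by
          rw [← ENNReal.ofReal_mul (Real.exp_pos _).le, ← ENNReal.ofReal_mul hp.le,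
            score_append_false, Real.exp_add, ← mul_exp_logOdds hp hp']
          congr 1; ring
        have e1 : ENNReal.ofReal (Real.exp (score p j h)) * ENNReal.ofReal p =
            ENNReal.ofReal (1 - p) *
              ENNReal.ofReal (Real.exp (score p j (h ++ [(j, true)]))) := by
          rw [← ENNReal.ofReal_mul (Real.exp_pos _).le, ← ENNReal.ofReal_mul h1p,
            score_append_true, sub_eq_add_neg (score p j h), Real.exp_add]
          congr 1
          linear_combination (-Real.exp (score p j h)) * mul_exp_neg_logOdds hp hp'
        simp only [hi, Function.update_self, Bool.bne_true, Bool.bne_false,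
          Bool.not_true, Bool.not_false, flipMass_true, flipMass_false,
          mul_add, ← mul_assoc, e0, e1]
      · rw [Function.update_of_ne hj, score_append_of_ne p hj, score_append_of_ne p hj]
        ring
    · rfl

/-- A likelihood ratio has mean one: this is the change of measure applied to the constant `1`. It
feeds the Markov bound for the bits that remain ones. -/
lemma mean_exp_score (A : Algorithm.{u} n) {p : I} (hp : 0 < (p : ℝ)) (hp' : (p : ℝ) < 1)
    (y : Fin n → Bool) (i : Fin n) (hi : y i = true) (t : ℕ) :
    A.mean p y t (fun _ h => ENNReal.ofReal (Real.exp (score p i h))) = 1 := by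
  have := A.mean_eq_mean_update hp hp' (Function.update y i false) i (by simp) t
    (fun _ _ => 1) (fun _ => measurable_const)
  rw [Function.update_idem, ← hi, Function.update_eq_self, mean_const] at this
  simpa using this.symm

/-- Wald's identity for the potential of a zero bit. -/
lemma mean_potential (A : Algorithm.{u} n) {p : I} (hp : 0 < (p : ℝ)) (hp' : (p : ℝ) < 1 / 2)
    (x : Fin n → Bool) (i : Fin n) (hi : x i = false) (t : ℕ) :
    A.mean p x t (fun _ h => potential p i h) =
      1 + ENNReal.ofReal ((1 - 2 * p) * logOdds p) *
        A.mean p x t (fun _ h => (h.countP fun a => a.1 = i : ℕ)) := by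
  induction t with
  | zero =>
    rw [mean_zero _ _ _ (fun _ h => potential p i h) fun _ => measurable_const,
      mean_zero _ _ _ (fun _ h => ((h.countP fun a => a.1 = i : ℕ) : ℝ≥0∞))
        fun _ => measurable_const]
    simp [potential]
  | succ t ih =>
    let q : A.Seed → List (Fin n × Bool) → ℝ≥0∞ := fun r h =>
      if A.next r h = Sum.inl i then 1 else 0
    have hq : ∀ h, Measurable fun r => q r h := fun h =>
      Measurable.ite (A.measurable_next h _) measurable_const measurable_const
    have hsum : ∀ c : Bool, flipMass p (xor c true) + flipMass p (xor c false) = 1 := by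
      intro c
      cases c <;> simp [flipMass_add, add_comm (flipMass p false)]
    have h1 : A.step p x (fun _ h => (h.countP fun a => a.1 = i : ℕ)) =
        fun r h => ((h.countP fun a => a.1 = i : ℕ) : ℝ≥0∞) + q r h := by
      funext r h
      simp only [step, q]
      rcases A.next r h with j | b
      · simp only [Fintype.sum_bool, List.countP_append, List.countP_singleton, ← add_mul, hsum]
        by_cases hj : j = i <;> simp [hj]
      · simp
    have h2 : A.step p x (fun _ h => potential p i h) =
        fun r h => potential p i h + ENNReal.ofReal ((1 - 2 * p) * logOdds p) * q r h := by
      funext r h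
      simp only [step, q]
      rcases A.next r h with j | b
      · by_cases hj : j = i
        · subst hj
          have hl := logOdds_pos hp hp'
          have h1p : (0 : ℝ) ≤ 1 - p := by linarith
          simp only [Fintype.sum_bool, hi, Bool.xor_true, Bool.xor_false, flipMass_true, Bool.not_false,
            flipMass_false, potential, score_append_true, score_append_false, if_true, mul_one]
          rw [← ENNReal.ofReal_mul hp.le, ← ENNReal.ofReal_mul h1p,
            ← ENNReal.ofReal_add (mul_nonneg hp.le (add_exp_neg_nonneg _))
              (mul_nonneg h1p (add_exp_neg_nonneg _)),
            ← ENNReal.ofReal_add (add_exp_neg_nonneg _) (mul_nonneg (by linarith) hl.le)]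
          congr 1
          rw [show -(score p j h - logOdds p) = -score p j h + logOdds p by ring,
            show -(score p j h + logOdds p) = -score p j h + -logOdds p by ring,
            Real.exp_add, Real.exp_add]
          -- Under a zero bit `exp (-score)` is a martingale, because `p * exp L + (1 - p) * exp
          -- (-L) = (1 - p) + p = 1` for `L = logOdds p`. Only the linear term drifts.
          linear_combination Real.exp (-score p j h) * mul_exp_logOdds hp (by linarith) +
            Real.exp (-score p j h) * mul_exp_neg_logOdds hp (by linarith)
        · simp only [Fintype.sum_bool, potential, score_append_of_ne p hj, ← add_mul, hsum]
          simp [hj]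
      · simp
    rw [mean_succ _ _ _ _ (fun _ h => potential p i h) fun _ => measurable_const,
      mean_succ _ _ _ _ (fun _ h => ((h.countP fun a => a.1 = i : ℕ) : ℝ≥0∞))
        fun _ => measurable_const,
      h1, h2, mean_add _ _ _ _ (fun _ h => potential p i h) _ fun _ => measurable_const,
      mean_add _ _ _ _ (fun _ h => ((h.countP fun a => a.1 = i : ℕ) : ℝ≥0∞)) _
        fun _ => measurable_const, ih, mean_const_mul _ _ _ _ _ _ hq, mul_add,
      add_assoc]

lemma sum_mean_countP_le (A : Algorithm.{u} n) (p : I) (x : Fin n → Bool) (t : ℕ) :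
    ∑ i, A.mean p x t (fun _ h => (h.countP fun a => a.1 = i : ℕ)) ≤ A.expectedQueries p x := by
  rw [← mean_finset_sum _ _ _ _ _ (fun i _ h => ((h.countP fun a => a.1 = i : ℕ) : ℝ≥0∞))
    fun _ _ => measurable_const]
  refine lintegral_mono fun ω => ?_
  have : ∀ h : List (Fin n × Bool), ∑ i, h.countP (fun a => a.1 = i) = h.length := by
    intro h
    induction h with
    | nil => simp
    | cons a h ih => simp [List.countP_cons, Finset.sum_add_distrib, ih]
  beta_reduce
  rw [← Nat.cast_sum, this]
  exact le_iSup (fun t => ((A.history x ω.1 ω.2 t).length : ℝ≥0∞)) t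

/-! ### Outputs at a finite time and error probabilities -/

lemma history_eq_of_le (A : Algorithm.{u} n) (x : Fin n → Bool) (r : A.Seed) (z : Fin n × ℕ → Bool)
    {b : Bool} {t t' : ℕ} (h : A.next r (A.history x r z t) = Sum.inr b) (htt' : t ≤ t') :
    A.history x r z t' = A.history x r z t := by
  induction t', htt' using Nat.le_induction with
  | base => rfl
  | succ t' _ ih =>
    rw [← ih] at h
    rw [← ih]
    conv_lhs => rw [history]
    simp only [h]

lemma not_outputs_true_of_outputs_false (A : Algorithm.{u} n) (x : Fin n → Bool) (r : A.Seed)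
    (z : Fin n × ℕ → Bool) (h : A.Outputs x r z false) : ¬ A.Outputs x r z true := by
  rintro ⟨t', h'⟩
  obtain ⟨t, h⟩ := h
  rcases le_total t t' with htt | htt
  · rw [A.history_eq_of_le x r z h htt, h] at h'
    simp at h'
  · rw [A.history_eq_of_le x r z h' htt, h'] at h
    simp at h

/-- The event that the algorithm has stopped with output `0`, as a function of seed and history. -/
def outFalse (A : Algorithm.{u} n) (r : A.Seed) (h : List (Fin n × Bool)) : Prop :=
  A.next r h = Sum.inr false

open Classical in
lemma mean_outFalse_le (A : Algorithm.{u} n) (p : I) (f : (Fin n → Bool) → Bool)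
    (x : Fin n → Bool) (hx : f x = true) (t : ℕ) :
    A.mean p x t (fun r h => if A.outFalse r h then 1 else 0) ≤ A.worstCaseError p f := by
  refine le_trans ?_ (le_iSup _ x)
  have hm : MeasurableSet {ω : A.Seed × (Fin n × ℕ → Bool) |
      A.outFalse ω.1 (A.history x ω.1 ω.2 t)} := by
    have := A.measurable_comp_history x t (fun r h => if A.outFalse r h then 1 else 0)
      (fun h => Measurable.ite (A.measurable_next h _) measurable_const measurable_const)
      (measurableSet_singleton 1)
    convert this using 1
    ext ω; simp
  have : A.mean p x t (fun r h => if A.outFalse r h then 1 else 0) = A.law p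
      {ω | A.outFalse ω.1 (A.history x ω.1 ω.2 t)} := by
    rw [← lintegral_indicator_one hm]
    rfl
  rw [this, errorProb, hx]
  exact measure_mono fun ω hω => A.not_outputs_true_of_outputs_false x ω.1 ω.2 ⟨t, hω⟩

open Classical in
-- The events "not yet stopped with output false" decrease in `t` to the error event, so continuity
-- from above applies. The strict inequality `hδ` leaves the room needed to pass to a finite time,
-- where the one-step calculus is available.
lemma eventually_mean_not_outFalse_le (A : Algorithm.{u} n) (p : I) (f : (Fin n → Bool) → Bool)
    (x : Fin n → Bool) (hx : f x = false) (δ : ℝ≥0∞) (hδ : A.worstCaseError p f < δ) :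
    ∀ᶠ t in atTop, A.mean p x t (fun r h => if A.outFalse r h then 0 else 1) ≤ δ := by
  have hm : ∀ t, MeasurableSet {ω : A.Seed × (Fin n × ℕ → Bool) |
      ¬ A.outFalse ω.1 (A.history x ω.1 ω.2 t)} := by
    intro t
    have := A.measurable_comp_history x t (fun r h => if A.outFalse r h then 0 else 1)
      (fun h => Measurable.ite (A.measurable_next h _) measurable_const measurable_const)
      (measurableSet_singleton 1)
    convert this using 1
    ext ω; simp
  have heq : ∀ t, A.mean p x t (fun r h => if A.outFalse r h then 0 else 1) = A.law p
      {ω | ¬ A.outFalse ω.1 (A.history x ω.1 ω.2 t)} := by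
    intro t
    rw [← lintegral_indicator_one (hm t), mean]
    refine lintegral_congr fun ω => ?_
    by_cases h : A.outFalse ω.1 (A.history x ω.1 ω.2 t) <;> simp [h]
  have hanti : Antitone fun t => {ω : A.Seed × (Fin n × ℕ → Bool) |
      ¬ A.outFalse ω.1 (A.history x ω.1 ω.2 t)} := by
    intro t t' htt' ω hω hω'
    refine hω ?_
    unfold outFalse at hω' ⊢
    rw [A.history_eq_of_le x ω.1 ω.2 hω' htt']
    exact hω'
  have hlim := tendsto_measure_iInter_atTop (μ := A.law p) (fun t => (hm t).nullMeasurableSet) hanti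
    ⟨0, measure_ne_top _ _⟩
  have hlt : A.law p (⋂ t, {ω : A.Seed × (Fin n × ℕ → Bool) |
      ¬ A.outFalse ω.1 (A.history x ω.1 ω.2 t)}) < δ := by
    refine lt_of_le_of_lt ?_ hδ
    refine le_trans (le_of_eq ?_) (le_iSup _ x)
    rw [errorProb, hx]
    congr 1
    ext ω
    simp [Outputs, outFalse]
  filter_upwards [hlim.eventually_lt_const hlt] with t ht
  rw [heq]
  exact ht.le

end Algorithm

/-! ### Neighbouring inputs and double counting -/

/-- The input whose ones are the elements of `s`. -/
def indicatorInput (s : Finset (Fin n)) : Fin n → Bool := fun i => decide (i ∈ s)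

lemma update_indicatorInput_erase {s : Finset (Fin n)} {i : Fin n} (hi : i ∈ s) :
    Function.update (indicatorInput (s.erase i)) i true = indicatorInput s := by
  funext j
  by_cases hj : j = i
  · subst hj; simp [indicatorInput, hi]
  · simp [indicatorInput, hj]

lemma threshold_indicatorInput (k : ℕ) (s : Finset (Fin n)) :
    threshold k (indicatorInput s) = decide (k ≤ s.card) := by
  simp [threshold, indicatorInput]

/-- Double counting: a `(k + 1)`-set with a marked element is a `k`-set with a marked element
outside it. This regroups query counts by the input on which they are made. -/
lemma sum_powersetCard_succ_erase (k : ℕ) (m : Finset (Fin n) → Fin n → ℝ≥0∞) :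
    ∑ s ∈ Finset.powersetCard (k + 1) Finset.univ, ∑ i ∈ s, m (s.erase i) i =
      ∑ s ∈ Finset.powersetCard k Finset.univ, ∑ i ∈ sᶜ, m s i := by
  rw [Finset.sum_sigma', Finset.sum_sigma']
  refine Finset.sum_nbij' (fun a => ⟨a.1.erase a.2, a.2⟩) (fun a => ⟨insert a.2 a.1, a.2⟩)
    ?_ ?_ ?_ ?_ ?_
  · rintro ⟨s, i⟩ h
    simp only [Finset.mem_sigma, Finset.mem_powersetCard_univ] at h ⊢
    refine ⟨?_, by simp⟩
    rw [Finset.card_erase_of_mem h.2, h.1]; rfl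
  · rintro ⟨s, i⟩ h
    simp only [Finset.mem_sigma, Finset.mem_powersetCard_univ, Finset.mem_compl] at h ⊢
    refine ⟨?_, by simp⟩
    rw [Finset.card_insert_of_notMem h.2, h.1]
  · rintro ⟨s, i⟩ h
    simp only [Finset.mem_sigma] at h
    simp [Finset.insert_erase h.2]
  · rintro ⟨s, i⟩ h
    simp only [Finset.mem_sigma, Finset.mem_compl] at h
    simp [Finset.erase_insert h.2]
  · rintro ⟨s, i⟩ h
    rfl

/-! ### The trade-off between error and queries -/

namespace Algorithm

/-- The algorithm has output `0`, although the input `s` is not much less likely than a random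
input obtained from it by removing a one. -/
def plausiblyFalse (A : Algorithm.{u} n) (p : I) (s : Finset (Fin n)) (W : ℝ) (r : A.Seed)
    (h : List (Fin n × Bool)) : Prop :=
  A.outFalse r h ∧ ∑ j ∈ s, Real.exp (score p j h) ≤ W

open Classical in
lemma measurable_ite_outFalse (A : Algorithm.{u} n) (a b : ℝ≥0∞) (h : List (Fin n × Bool)) :
    Measurable fun r => if A.outFalse r h then a else b :=
  Measurable.ite (A.measurable_next h _) measurable_const measurable_const

open Classical in
lemma measurable_ite_plausiblyFalse (A : Algorithm.{u} n) (p : I) (s : Finset (Fin n)) (W : ℝ)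
    (h : List (Fin n × Bool)) :
    Measurable fun r => if A.plausiblyFalse p s W r h then (1 : ℝ≥0∞) else 0 := by
  refine Measurable.ite ?_ measurable_const measurable_const
  exact (A.measurable_next h _).inter (MeasurableSet.const _)

open Classical in
-- A pointwise case split shows that one of four alternatives always holds; each summand bounds the
-- probability of one of them. The two large-score alternatives use Markov: through `potential` for
-- the removed bit `i`, and through mean one of the likelihood ratios for the other elements of `s`.
lemma one_le_mean_plausiblyFalse_add (A : Algorithm.{u} n) {p : I} (hp : 0 < (p : ℝ))
    (hp' : (p : ℝ) < 1 / 2) (s : Finset (Fin n)) (i : Fin n) (hi : i ∈ s) (t : ℕ)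
    {B K : ℝ} (hB : 0 < B) (hK : 0 < K) :
    1 ≤ A.mean p (indicatorInput (s.erase i)) t (fun r h =>
          if A.plausiblyFalse p s (Real.exp B + s.card * K) r h then 1 else 0) +
        (A.mean p (indicatorInput (s.erase i)) t (fun r h => if A.outFalse r h then 0 else 1) +
        ((ENNReal.ofReal B)⁻¹ * (1 + ENNReal.ofReal ((1 - 2 * p) * logOdds p) *
          A.mean p (indicatorInput (s.erase i)) t
            (fun _ h => (h.countP fun a => a.1 = i : ℕ))) + ENNReal.ofReal (1 / K))) := by
  have hs : (0 : ℝ) < s.card := by exact_mod_cast Finset.card_pos.2 ⟨i, hi⟩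
  set x := indicatorInput (s.erase i) with hx
  have hpw : A.mean p x t (fun _ _ => 1) ≤ A.mean p x t (fun r h =>
      (if A.plausiblyFalse p s (Real.exp B + s.card * K) r h then 1 else 0) +
      ((if A.outFalse r h then 0 else 1) + ((ENNReal.ofReal B)⁻¹ * potential p i h +
        ENNReal.ofReal (1 / (s.card * K)) *
          ∑ j ∈ s.erase i, ENNReal.ofReal (Real.exp (score p j h))))) := by
    refine A.mean_mono p x t fun r h => ?_
    by_cases h1 : A.outFalse r h
    swap
    · simp only [h1, if_false]
      exact le_trans le_self_add le_add_self
    by_cases h2 : ∑ j ∈ s, Real.exp (score p j h) ≤ Real.exp B + s.card * K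
    · have : A.plausiblyFalse p s (Real.exp B + s.card * K) r h := ⟨h1, h2⟩
      simp only [this, if_true]
      exact le_self_add
    push Not at h2
    refine le_trans ?_ (le_trans le_add_self le_add_self)
    rw [← Finset.add_sum_erase s _ hi] at h2
    -- If the sum exceeds `exp B + s.card * K`, either the `i`-th term exceeds `exp B` or the
    -- remaining terms exceed `s.card * K`.
    by_cases h3 : B < score p i h
    · refine le_trans ?_ le_self_add
      rw [mul_comm, ← div_eq_mul_inv, ENNReal.le_div_iff_mul_le
        (Or.inl (by simpa using hB)) (Or.inl ENNReal.ofReal_ne_top), one_mul]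
      refine ENNReal.ofReal_le_ofReal ?_
      linarith [Real.exp_pos (-score p i h)]
    · refine le_trans ?_ le_add_self
      have h4 : s.card * K ≤ ∑ j ∈ s.erase i, Real.exp (score p j h) := by
        have := Real.exp_le_exp.2 (not_lt.1 h3)
        linarith
      rw [← ENNReal.ofReal_sum_of_nonneg fun j _ => (Real.exp_pos _).le,
        ← ENNReal.ofReal_mul (by positivity), ← ENNReal.ofReal_one]
      refine ENNReal.ofReal_le_ofReal ?_
      rw [one_div, ← div_eq_inv_mul, le_div_iff₀ (by positivity), one_mul]
      exact h4
  refine (A.mean_const p x t 1).symm.trans_le (hpw.trans ?_)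
  rw [mean_add _ _ _ _ _ _ (A.measurable_ite_plausiblyFalse p s _),
    mean_add _ _ _ _ _ _ (A.measurable_ite_outFalse 0 1),
    mean_add _ _ _ _ (fun _ h => (ENNReal.ofReal B)⁻¹ * potential p i h) _
      fun _ => measurable_const,
    mean_const_mul _ _ _ _ _ (fun _ h => potential p i h) fun _ => measurable_const,
    mean_const_mul _ _ _ _ _ (fun _ h => ∑ j ∈ s.erase i,
      ENNReal.ofReal (Real.exp (score p j h))) fun _ => measurable_const,
    mean_finset_sum _ _ _ _ _ (fun j _ h => ENNReal.ofReal (Real.exp (score p j h)))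
      fun _ _ => measurable_const,
    A.mean_potential hp hp' x i (by simp [hx, indicatorInput]) t]
  gcongr
  rw [Finset.sum_congr rfl fun j hj => A.mean_exp_score hp (by linarith) x j
    (by simpa [hx, indicatorInput] using hj) t, Finset.sum_const, nsmul_eq_mul, mul_one,
    ← ENNReal.ofReal_natCast, ← ENNReal.ofReal_mul (by positivity)]
  refine ENNReal.ofReal_le_ofReal ?_
  have : ((s.erase i).card : ℝ) ≤ s.card := by
    exact_mod_cast Finset.card_le_card (Finset.erase_subset _ _)
  calc 1 / (s.card * K) * ((s.erase i).card : ℝ) ≤ 1 / (s.card * K) * s.card := by gcongr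
    _ = 1 / K := by field_simp

open Classical in
-- Each summand is transported to the common input `s`. There the weights `exp (score p i)` add up
-- to at most `W` on the event, by its definition, and the event implies output false.
lemma sum_mean_plausiblyFalse_le (A : Algorithm.{u} n) {p : I} (hp : 0 < (p : ℝ))
    (hp' : (p : ℝ) < 1) (s : Finset (Fin n)) (t : ℕ) (W : ℝ) :
    ∑ i ∈ s, A.mean p (indicatorInput (s.erase i)) t
        (fun r h => if A.plausiblyFalse p s W r h then 1 else 0) ≤
      ENNReal.ofReal W * A.mean p (indicatorInput s) t
        (fun r h => if A.outFalse r h then 1 else 0) := by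
  have hm := A.measurable_ite_plausiblyFalse p s W
  rw [← mean_const_mul _ _ _ _ _ _ (A.measurable_ite_outFalse 1 0)]
  have : ∀ i ∈ s, A.mean p (indicatorInput (s.erase i)) t
      (fun r h => if A.plausiblyFalse p s W r h then 1 else 0) =
      A.mean p (indicatorInput s) t (fun r h => ENNReal.ofReal (Real.exp (score p i h)) *
        if A.plausiblyFalse p s W r h then 1 else 0) := by
    intro i hi
    rw [A.mean_eq_mean_update hp hp' _ i (by simp [indicatorInput]) t _ hm,
      update_indicatorInput_erase hi]
  rw [Finset.sum_congr rfl this, ← mean_finset_sum _ _ _ _ _ _ fun i h => (hm h).const_mul _]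
  refine A.mean_mono _ _ _ fun r h => ?_
  rw [← Finset.sum_mul]
  by_cases h1 : A.plausiblyFalse p s W r h
  · simp only [h1, h1.1, if_true, mul_one]
    rw [← ENNReal.ofReal_sum_of_nonneg fun j _ => (Real.exp_pos _).le]
    exact ENNReal.ofReal_le_ofReal h1.2
  · simp [h1]

open Classical in
/-- The trade-off between the error probability and the query complexity of threshold `k + 1`. -/
lemma one_le_of_worstCaseError_lt (A : Algorithm.{u} n) {p : I} (hp : 0 < (p : ℝ))
    (hp' : (p : ℝ) < 1 / 2) (k : ℕ) (hk : k < n) {B K Q δ : ℝ} (hB : 0 < B) (hK : 0 < K)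
    (hQ : 0 ≤ Q) (hδ : 0 ≤ δ) (hA : ∀ x, A.expectedQueries p x ≤ ENNReal.ofReal Q)
    (herr : A.worstCaseError p (threshold (k + 1)) < ENNReal.ofReal δ) :
    1 ≤ (Real.exp B / (k + 1 : ℕ) + K) * δ + δ + 1 / B + 1 / K +
      (1 - 2 * p) * logOdds p * Q / (B * (n - k)) := by
  set D := (1 - 2 * p) * logOdds p with hD
  have hD0 : 0 ≤ D := mul_nonneg (by linarith) (logOdds_pos hp hp').le
  have hthr : ∀ s : Finset (Fin n), s.card = k → threshold (k + 1) (indicatorInput s) = false := by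
    intro s hs; simp [threshold_indicatorInput, hs]
  have hthr' : ∀ s : Finset (Fin n), s.card = k + 1 →
      threshold (k + 1) (indicatorInput s) = true := by
    intro s hs; simp [threshold_indicatorInput, hs]
  -- One finite time serves all inputs, as there are finitely many sets `s`.
  obtain ⟨t, ht⟩ : ∃ t, ∀ s : Finset (Fin n), s.card = k →
      A.mean p (indicatorInput s) t (fun r h => if A.outFalse r h then 0 else 1) ≤
        ENNReal.ofReal δ := by
    refine (eventually_all (l := atTop).2 fun s => ?_).exists
    by_cases hs : s.card = k
    · filter_upwards [A.eventually_mean_not_outFalse_le p _ _ (hthr s hs) _ herr] with t ht _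
      exact ht
    · exact Eventually.of_forall fun t h => absurd h hs
  set W := Real.exp B + (k + 1 : ℕ) * K with hW
  let m : Finset (Fin n) → Fin n → ℝ≥0∞ := fun s i =>
    A.mean p (indicatorInput s) t (fun _ h => (h.countP fun a => a.1 = i : ℕ))
  have hone : ∀ s ∈ Finset.powersetCard (k + 1) (Finset.univ : Finset (Fin n)),
      ((k + 1 : ℕ) : ℝ≥0∞) ≤ ENNReal.ofReal W * ENNReal.ofReal δ +
        (k + 1 : ℕ) * (ENNReal.ofReal δ + ((ENNReal.ofReal B)⁻¹ + ENNReal.ofReal (1 / K))) +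
        (ENNReal.ofReal B)⁻¹ * ENNReal.ofReal D * ∑ i ∈ s, m (s.erase i) i := by
    intro s hs
    rw [Finset.mem_powersetCard_univ] at hs
    have h1 := Finset.sum_le_sum fun i (hi : i ∈ s) =>
      A.one_le_mean_plausiblyFalse_add hp hp' s i hi t hB hK
    rw [Finset.sum_add_distrib, Finset.sum_const, hs, nsmul_eq_mul, mul_one] at h1
    refine h1.trans ?_
    have h2 := A.sum_mean_plausiblyFalse_le hp (by linarith) s t W
    have h3 := A.mean_outFalse_le p (threshold (k + 1)) _ (hthr' s hs) t
    have h4 : ∀ i ∈ s, A.mean p (indicatorInput (s.erase i)) t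
        (fun r h => if A.outFalse r h then 0 else 1) +
        ((ENNReal.ofReal B)⁻¹ * (1 + ENNReal.ofReal D * m (s.erase i) i) +
          ENNReal.ofReal (1 / K)) ≤
        (ENNReal.ofReal δ + ((ENNReal.ofReal B)⁻¹ + ENNReal.ofReal (1 / K))) +
        (ENNReal.ofReal B)⁻¹ * ENNReal.ofReal D * m (s.erase i) i := by
      intro i hi
      have := ht (s.erase i) (by rw [Finset.card_erase_of_mem hi, hs]; rfl)
      calc _ ≤ ENNReal.ofReal δ + ((ENNReal.ofReal B)⁻¹ * (1 + ENNReal.ofReal D * m (s.erase i) i) +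
          ENNReal.ofReal (1 / K)) := by gcongr
        _ = _ := by ring
    have h5 := (Finset.sum_le_sum h4).trans_eq Finset.sum_add_distrib
    rw [Finset.sum_const, hs, nsmul_eq_mul, ← Finset.mul_sum] at h5
    calc _ ≤ ENNReal.ofReal W * ENNReal.ofReal δ + _ :=
          add_le_add (h2.trans (by gcongr; exact h3.trans herr.le)) h5
      _ = _ := by rw [add_assoc]
  have hsum := Finset.sum_le_sum hone
  rw [Finset.sum_add_distrib, Finset.sum_const, Finset.sum_const, ← Finset.mul_sum,
    sum_powersetCard_succ_erase, Finset.card_powersetCard, Finset.card_univ, Fintype.card_fin,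
    nsmul_eq_mul, nsmul_eq_mul] at hsum
  -- For each `k`-set, the queries spent on its zeros are part of one budget `Q`.
  have hm : ∑ s ∈ Finset.powersetCard k (Finset.univ : Finset (Fin n)), ∑ i ∈ sᶜ, m s i ≤
      n.choose k * ENNReal.ofReal Q := by
    have : ∀ s ∈ Finset.powersetCard k (Finset.univ : Finset (Fin n)),
        ∑ i ∈ sᶜ, m s i ≤ ENNReal.ofReal Q := fun s _ =>
      (Finset.sum_le_sum_of_subset (Finset.subset_univ _)).trans
        ((A.sum_mean_countP_le p _ t).trans (hA _))
    refine (Finset.sum_le_sum this).trans ?_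
    simp
  have hW0 : 0 ≤ W := by positivity
  have hreal : ((n.choose (k + 1) : ℕ) : ℝ) * (k + 1 : ℕ) ≤ (n.choose (k + 1) : ℕ) *
      (W * δ + (k + 1 : ℕ) * (δ + (B⁻¹ + 1 / K))) + B⁻¹ * D * ((n.choose k : ℕ) * Q) := by
    rw [← ENNReal.ofReal_le_ofReal_iff (by positivity)]
    clear_value W D
    have hsum' := hsum.trans (add_le_add_right (mul_le_mul_right hm _) _)
    refine le_trans (le_of_eq ?_) (hsum'.trans (le_of_eq ?_))
    · rw [ENNReal.ofReal_mul (by positivity), ENNReal.ofReal_natCast, ENNReal.ofReal_natCast]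
    · rw [← ENNReal.ofReal_inv_of_pos hB, ENNReal.ofReal_add (by positivity) (by positivity),
        ENNReal.ofReal_mul (by positivity), ENNReal.ofReal_add (by positivity) (by positivity),
        ENNReal.ofReal_mul (by positivity), ENNReal.ofReal_mul (by positivity),
        ENNReal.ofReal_add (by positivity) (by positivity),
        ENNReal.ofReal_add (by positivity) (by positivity), ENNReal.ofReal_mul (by positivity),
        ENNReal.ofReal_mul (by positivity), ENNReal.ofReal_mul (by positivity),
        ENNReal.ofReal_natCast, ENNReal.ofReal_natCast, ENNReal.ofReal_natCast]
  -- The two counts of the pairs; dividing by this number turns the sum into an average and creates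
  -- the factor `n - k`.
  have hch : ((n.choose (k + 1) : ℕ) : ℝ) * (k + 1 : ℕ) = (n.choose k : ℕ) * (n - k) := by
    have := Nat.choose_succ_right_eq n k
    rw [← Nat.cast_sub hk.le]
    exact_mod_cast this
  have hc : (0 : ℝ) < (n.choose (k + 1) : ℕ) := by exact_mod_cast Nat.choose_pos hk
  have hc' : (0 : ℝ) < (n.choose k : ℕ) := by exact_mod_cast Nat.choose_pos hk.le
  have hnk : (0 : ℝ) < n - k := by
    have : (k : ℝ) < n := by exact_mod_cast hk
    linarith
  have hk1 : (0 : ℝ) < (k + 1 : ℕ) := by positivity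
  have hpos := mul_pos hc hk1
  refine le_of_mul_le_mul_left ?_ hpos
  rw [mul_one]
  refine hreal.trans (le_of_eq ?_)
  rw [mul_add (((n.choose (k + 1) : ℕ) : ℝ) * (k + 1 : ℕ)) _ (D * Q / (B * (n - k)))]
  congr 1
  · rw [hW]; field_simp; ring
  · rw [hch]; field_simp

end Algorithm

/-! ### The divergence in closed form -/

/-- The log-likelihood ratio is `-logOdds p` at `true` and `logOdds p` at `false`; its mean is `(-p
+ (1 - p)) * logOdds p`, the drift of the score of a zero bit. -/
lemma klBernoulli_symm {p : I} (hp : 0 < (p : ℝ)) (hp' : (p : ℝ) < 1) :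
    klBernoulli p (unitInterval.symm p) = (1 - 2 * p) * logOdds p := by
  let f : Bool → ℝ≥0∞ := fun c => flipMass p c / flipMass (unitInterval.symm p) c
  have h1p : (0 : ℝ) < 1 - p := by linarith
  have h0 : ∀ c, flipMass (unitInterval.symm p) c ≠ 0 := by
    intro c; cases c <;> simp [flipMass, hp, hp']
  have htop : ∀ c, flipMass (unitInterval.symm p) c ≠ ⊤ := fun c => ENNReal.ofReal_ne_top
  have hden : bernoulliMeasure true false p =
      (bernoulliMeasure true false (unitInterval.symm p)).withDensity f := by
    refine Measure.ext_of_singleton fun c => ?_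
    rw [withDensity_apply _ (measurableSet_singleton c), lintegral_singleton,
      bernoulliMeasure_singleton, bernoulliMeasure_singleton,
      ENNReal.div_mul_cancel (h0 c) (htop c)]
  have hac : bernoulliMeasure true false p ≪
      bernoulliMeasure true false (unitInterval.symm p) := by
    rw [hden]; exact withDensity_absolutelyContinuous _ _
  have hrn : (bernoulliMeasure true false p).rnDeriv
      (bernoulliMeasure true false (unitInterval.symm p))
      =ᵐ[bernoulliMeasure true false p] f := by
    refine hac.ae_le ?_
    have := Measure.rnDeriv_withDensity (bernoulliMeasure true false (unitInterval.symm p))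
      (measurable_of_countable f)
    rwa [← hden] at this
  rw [klBernoulli, InformationTheory.toReal_klDiv_of_measure_eq hac (by simp)]
  have : llr (bernoulliMeasure true false p) (bernoulliMeasure true false (unitInterval.symm p))
      =ᵐ[bernoulliMeasure true false p] fun c => Real.log (f c).toReal := by
    filter_upwards [hrn] with c hc
    rw [llr_def]; simp only [hc]
  rw [integral_congr_ae this, integral_bernoulliMeasure]
  have ht : Real.log (f true).toReal = -logOdds p := by
    simp only [f, flipMass, if_true, ENNReal.toReal_div, ENNReal.toReal_ofReal hp.le,
      unitInterval.coe_symm_eq, ENNReal.toReal_ofReal h1p.le, logOdds]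
    rw [← Real.log_inv, inv_div]
  have hf : Real.log (f false).toReal = logOdds p := by
    simp [f, flipMass, ENNReal.toReal_div, ENNReal.toReal_ofReal hp.le,
      ENNReal.toReal_ofReal h1p.le, logOdds]
  rw [ht, hf]
  simp
  ring

end NoisyThreshold

end

/-! ### From fixed `ε` to a vanishing sequence, and the theorem -/

/-- A monotone property of `ε` that holds eventually for each `ε ∈ (0, 1)` holds eventually along
some vanishing sequence. -/
lemma exists_isLittleO_one_of_eventually (P : ℕ → ℝ → Prop)
    (hP : ∀ ε, 0 < ε → ε < 1 → ∀ᶠ n in atTop, P n ε)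
    (hmono : ∀ᶠ n in atTop, ∀ ε ε', ε ≤ ε' → P n ε → P n ε') :
    ∃ ε : ℕ → ℝ, ε =o[atTop] (fun _ => (1 : ℝ)) ∧ ∀ᶠ n in atTop, P n (ε n) := by
  let S : ℕ → Set ℝ := fun n => {ε | 0 < ε ∧ P n ε}
  have hbdd : ∀ n, BddBelow (S n) := fun n => ⟨0, fun ε hε => hε.1.le⟩
  have hnn : ∀ n, 0 ≤ sInf (S n) := fun n => Real.sInf_nonneg fun ε hε => hε.1.le
  -- The infimum need not be attained; the vanishing slack puts the value strictly above some
  -- admissible `ε`, and monotonicity does the rest.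
  refine ⟨fun n => sInf (S n) + 1 / ((n : ℝ) + 1), ?_, ?_⟩
  · rw [isLittleO_one_iff]
    have h1 : Tendsto (fun n => sInf (S n)) atTop (𝓝 0) := by
      rw [tendsto_order]
      refine ⟨fun a ha => Eventually.of_forall fun n => ha.trans_le (hnn n), fun a ha => ?_⟩
      have hm : 0 < min (a / 2) (1 / 2) := lt_min (by linarith) (by norm_num)
      filter_upwards [hP _ hm (lt_of_le_of_lt (min_le_right _ _) (by norm_num))] with n hn
      exact (csInf_le (hbdd n) ⟨hm, hn⟩).trans_lt
        (lt_of_le_of_lt (min_le_left _ _) (by linarith))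
    simpa using h1.add tendsto_one_div_add_atTop_nhds_zero_nat
  · filter_upwards [hP (1 / 2) (by norm_num) (by norm_num), hmono] with n hn hm
    have hlt : sInf (S n) < sInf (S n) + 1 / ((n : ℝ) + 1) :=
      lt_add_of_pos_right _ (by positivity)
    have hne : (S n).Nonempty := ⟨1 / 2, by norm_num, hn⟩
    obtain ⟨ε, hε, hεlt⟩ := exists_lt_of_csInf_lt hne hlt
    exact hm _ _ hεlt.le hε.2

theorem theorem1 (p : unitInterval) (hp_pos : 0 < (p : ℝ)) (hp_half : (p : ℝ) < 1 / 2)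
    (k : ℕ → ℕ) (δ : ℕ → ℝ)
    (hk_pos : ∀ᶠ n in atTop, 1 ≤ k n) (hδ_pos : ∀ᶠ n in atTop, 0 < δ n)
    (hk : (fun n => (k n : ℝ)) =o[atTop] fun n => (n : ℝ))
    (hδ : δ =o[atTop] fun _ => (1 : ℝ)) :
    ∃ ε : ℕ → ℝ, ε =o[atTop] (fun _ => (1 : ℝ)) ∧
      ∀ᶠ n in atTop, ∀ A : NoisyThreshold.Algorithm.{u} n,
        (∀ x : Fin n → Bool,
          A.expectedQueries p x ≤
            ENNReal.ofReal ((1 - ε n) * (n * Real.log (k n / δ n) /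
              NoisyThreshold.klBernoulli p (unitInterval.symm p)))) →
        ENNReal.ofReal (δ n) ≤ A.worstCaseError p (NoisyThreshold.threshold (k n)) := by
  rw [NoisyThreshold.klBernoulli_symm hp_pos (by linarith)]
  have hD : 0 < (1 - 2 * (p : ℝ)) * NoisyThreshold.logOdds p :=
    mul_pos (by linarith) (NoisyThreshold.logOdds_pos hp_pos hp_half)
  have hδ0 : Tendsto δ atTop (𝓝 0) := (isLittleO_one_iff ℝ).1 hδ
  have hlog : Tendsto (fun n => Real.log (k n / δ n)) atTop atTop := by
    refine Real.tendsto_log_atTop.comp ?_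
    have h1 : Tendsto (fun n => (δ n)⁻¹) atTop atTop :=
      tendsto_inv_nhdsGT_zero.comp (tendsto_nhdsWithin_iff.2 ⟨hδ0, hδ_pos⟩)
    refine tendsto_atTop_mono' _ ?_ h1
    filter_upwards [hk_pos, hδ_pos] with n hkn hδn
    rw [← one_div]
    have : (1 : ℝ) ≤ k n := by exact_mod_cast hkn
    gcongr
  have hkn : Tendsto (fun n => (k n : ℝ) / n) atTop (𝓝 0) := hk.tendsto_div_nhds_zero
  refine exists_isLittleO_one_of_eventually (fun n ε => ∀ A : NoisyThreshold.Algorithm.{u} n,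
    (∀ x : Fin n → Bool, A.expectedQueries p x ≤ ENNReal.ofReal ((1 - ε) *
      (n * Real.log (k n / δ n) / ((1 - 2 * (p : ℝ)) * NoisyThreshold.logOdds p)))) →
    ENNReal.ofReal (δ n) ≤ A.worstCaseError p (NoisyThreshold.threshold (k n))) ?_ ?_
  · intro ε hε hε1
    have hr : (1 - ε) / (1 - ε / 2) < 1 := by
      rw [div_lt_one (by linarith)]; linarith
    set r := (1 - ε) / (1 - ε / 2) with hr_def
    -- The limit of the trade-off bound is `1 / K + r`. This `K` makes it `(1 + r) / 2 < 1`.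
    set K := 2 / (1 - r) with hK_def
    have hK : 0 < K := div_pos two_pos (by linarith)
    have hlim : Tendsto (fun n => Real.exp (-(ε / 2 * Real.log (k n / δ n))) + K * δ n + δ n +
        1 / ((1 - ε / 2) * Real.log (k n / δ n)) + 1 / K + r * (1 - (k n : ℝ) / n)⁻¹) atTop
        (𝓝 (0 + K * 0 + 0 + 0 + 1 / K + r * (1 - 0)⁻¹)) := by
      refine (((((Real.tendsto_exp_neg_atTop_nhds_zero.comp
        (hlog.const_mul_atTop (by linarith))).add (hδ0.const_mul K)).add hδ0).add ?_).add
          tendsto_const_nhds).add (((hkn.const_sub 1).inv₀ (by norm_num)).const_mul r)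
      simp only [one_div]
      exact tendsto_inv_atTop_zero.comp (hlog.const_mul_atTop (by linarith))
    have hlt : 0 + K * 0 + 0 + 0 + 1 / K + r * (1 - 0)⁻¹ < 1 := by
      rw [hK_def, one_div_div]; norm_num; linarith
    filter_upwards [hlim.eventually_lt_const hlt, hk_pos, hδ_pos, hlog.eventually_gt_atTop 0,
      hkn.eventually_lt_const one_pos, eventually_gt_atTop 0] with n hn hk1 hδn hΛ hlt1 hn0 A hA
    by_contra! herr
    have hn0' : (0 : ℝ) < n := by exact_mod_cast hn0
    have hkn' : k n < n := by
      rw [div_lt_one hn0'] at hlt1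
      exact_mod_cast hlt1
    -- The trade-off is indexed by the number `k'` of ones in the false inputs, one less than the
    -- threshold.
    obtain ⟨k', hk'⟩ : ∃ k', k n = k' + 1 := ⟨k n - 1, by omega⟩
    have hB : 0 < (1 - ε / 2) * Real.log (k n / δ n) := mul_pos (by linarith) hΛ
    have hmain := A.one_le_of_worstCaseError_lt hp_pos hp_half k' (by omega) hB hK
      (mul_nonneg (by linarith) (div_nonneg (by positivity) hD.le)) hδn.le hA (hk' ▸ herr)
    rw [← hk'] at hmain
    have hk0 : (0 : ℝ) < k n := by exact_mod_cast hk1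
    -- The choice of `B` just below `log (k / δ)` makes the change-of-measure cost a negative power
    -- of `k / δ`, hence vanishing.
    have hexp : Real.exp ((1 - ε / 2) * Real.log (k n / δ n)) / (k n) * δ n =
        Real.exp (-(ε / 2 * Real.log (k n / δ n))) := by
      rw [show (1 - ε / 2) * Real.log (k n / δ n) =
        Real.log (k n / δ n) + -(ε / 2 * Real.log (k n / δ n)) by ring, Real.exp_add,
        Real.exp_log (by positivity)]
      field_simp
    have hcast : (k n : ℝ) = k' + 1 := by exact_mod_cast hk'
    have hnk : (0 : ℝ) < n - k n := by
      have : (k n : ℝ) < n := by exact_mod_cast hkn'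
      linarith
    have hlast : (1 - 2 * (p : ℝ)) * NoisyThreshold.logOdds p * ((1 - ε) * (n *
        Real.log (k n / δ n) / ((1 - 2 * (p : ℝ)) * NoisyThreshold.logOdds p))) /
        ((1 - ε / 2) * Real.log (k n / δ n) * (n - k')) ≤ r * (1 - (k n : ℝ) / n)⁻¹ := by
      generalize (1 - 2 * (p : ℝ)) * NoisyThreshold.logOdds p = D at hD
      have hne : (1 - ε / 2) ≠ 0 := by linarith
      have hnk' : (0 : ℝ) < n - k' := by linarith
      have h1 : D * ((1 - ε) * (n * Real.log (k n / δ n) / D)) /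
          ((1 - ε / 2) * Real.log (k n / δ n) * (n - k')) = r * (n / (n - k')) := by
        rw [hr_def]; field_simp
      have h2 : (1 - (k n : ℝ) / n)⁻¹ = n / (n - k n) := by
        rw [one_sub_div hn0'.ne', inv_div]
      rw [h1, h2]
      have hr0 : 0 ≤ r := div_nonneg (by linarith) (by linarith)
      gcongr
      linarith
    rw [add_mul, hexp] at hmain
    linarith
  -- Once the logarithm is nonnegative, a larger `ε` means a smaller query budget, hence a stronger
  -- assumption on the algorithm.
  · filter_upwards [hlog.eventually_ge_atTop 0] with n hΛ ε ε' hεε' h A hA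
    refine h A fun x => (hA x).trans (ENNReal.ofReal_le_ofReal ?_)
    gcongr
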